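/- A generalised simultaneous game $\mathcal G=(I,(X_i,R_i,q_i,\varphi_i)_{i\in I})$ consists of a nonempty set $I$ of players and, for each $i\in I$, a nonempty set $X_i$ of moves, a set $R_i$ of outcomes, an outcome function $q_i:\prod_{j\in I}X_j\to R_i$ and a quantifier $\varphi_i:(X_i\to R_i)\to\mathcal P(R_i)$. For $\pi\in\prod_{j}X_j$ and $x\in X_i$ let $\pi(i\mapsto x)$ denote $\pi$ with its $i$th coordinate replaced by $x$. A generalised Nash equilibrium of $\mathcal G$ is a strategy profile $\pi\in\prod_{j}X_j$ with $$q_i(\pi)\in\varphi_i\bigl(x\mapsto q_i(\pi(i\mapsto x))\bigr)\quad\text{for all } i\in I;$$ equivalently, a fixed point of the best response correspondence $B(\pi)=\bigcap_{i\in I}\{\sigma : q_i(\pi(i\mapsto\sigma_i))\in\varphi_i(x\mapsto q_i(\pi(i\mapsto x)))\}$. The game $\mathcal G$ is finite if $I$ and all $X_i$ are finite, each $R_i$ is a ($T_1$) topological vector space over $\mathbb R$, and each $\varphi_i$ is total (that is, $\varphi_i(p)\neq\varnothing$ for all $p:X_i\to R_i$), has closed graph $\{(p,r): r\in\varphi_i(p)\}\subseteq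 (X_i\to R_i)\times R_i$, where $X_i\to R_i$ carries the topology of pointwise convergence, and has closed and convex values $\varphi_i(p)$. Its mixed extension $\mathcal G^*=(I,(X_i^*,R_i,q_i^*,\varphi_i^*)_{i\in I})$ has as move sets the standard simplices $X_i^*=\{a\in\mathbb R^{X_i} : a_x\ge 0 \text{ for all } x\in X_i,\ \sum_{x\in X_i} a_x=1\}$, outcome functions $$q_i^*(\pi)=\sum_{\sigma\in\prod_j X_j}\Bigl(\prod_{j\in I}\pi_{j,\sigma_j}\Bigr)\,q_i(\sigma),$$ and quantifiers $\varphi_i^*(p)=\varphi_i(p\circ\delta_i)$, where $\delta_i:X_i\to X_i^*$ sends $x$ to the vertex whose $x$th coordinate is $1$. **Theorem (existence theorem for finite games).** Let $\mathcal G$ be a finite game such that each $\varphi_i$ is attained by a selection function, that is, for each $i\in I$ there is $\varepsilon_i:(X_i\to R_i)\to X_i$ such that $p(\varepsilon_i(p))\in\varphi_i(p)$ for all $p:X_i\to R_i$ with $\varphi_i(p)\neq\varnothing$. Then $\mathcal G$ has a mixed-strategy generalised Nash equilibrium, that is, the mixed extension $\mathcal G^*$ has a generalised Nash equilibrium. 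-/

import Mathlib

universe u v w

/-- A quantifier `φ ∈ S_R(X) = (X → R) → 𝒫(R)`. -/
abbrev Quantifier (R : Type w) (X : Type v) : Type (max v w) := (X → R) → Set R

/-- A selection function `ε ∈ J_R(X) = (X → R) → X`. -/
abbrev SelectionFunction (R : Type w) (X : Type v) : Type (max v w) := (X → R) → X

namespace Quantifier

/-- The domain of a quantifier: the functions at which its value is nonempty. -/
def dom {R : Type w} {X : Type v} (φ : Quantifier R X) : Set (X → R) :=
  {p | (φ p).Nonempty}

/-- A quantifier is total if its domain is the set of all functions `X → R`. -/
def IsTotal {R : Type w} {X : Type v} (φ : Quantifier R X) : Prop :=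
  φ.dom = Set.univ

/-- The quantifier `φ` is attained by the selection function `ε`. -/
def IsAttainedBy {R : Type w} {X : Type v} (φ : Quantifier R X)
    (ε : SelectionFunction R X) : Prop :=
  ∀ p ∈ φ.dom, p (ε p) ∈ φ p

/-- The diagonal `Δ(φ)` of a quantifier. -/
def diagonal {R : Type w} {X : Type v} (φ : Quantifier R X) : Set ((X → R) × X) :=
  {px | px.1 px.2 ∈ φ px.1}

end Quantifier

/-- A set-valued map has the closed graph property if its graph is closed in the product
topology. For maps defined on a function type `X → R`, the topology Mathlib puts on the domain
is the topology of pointwise convergence. -/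
def HasClosedGraph {A : Type v} {B : Type w} [TopologicalSpace A] [TopologicalSpace B]
    (F : A → Set B) : Prop :=
  IsClosed {ab : A × B | ab.2 ∈ F ab.1}

/-- A generalised simultaneous game with players `I`, move sets `X i` and outcome spaces `R i`. -/
structure SimultaneousGame (I : Type u) (X : I → Type v) (R : I → Type w) where
  /-- There is at least one player. -/
  nonempty_players : Nonempty I
  /-- Every player has at least one move. -/
  nonempty_moves : ∀ i, Nonempty (X i)
  /-- The outcome function `q i` of player `i`. -/
  q : ∀ i, (∀ j, X j) → R i
  /-- The quantifier `φ i` of player `i`. -/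
  φ : ∀ i, Quantifier (R i) (X i)

namespace SimultaneousGame

variable {I : Type u} {X : I → Type v} {R : I → Type w}

/-- The `i`-th unilateral map: the outcomes of the unilateral changes of strategy by player `i`. -/
def unilateral [DecidableEq I] (G : SimultaneousGame I X R) (i : I) (π : ∀ j, X j) : X i → R i :=
  fun x => G.q i (Function.update π i x)

/-- The best response correspondence `B(π) = ⋂ i, B_i(π)`. -/
def bestResponse [DecidableEq I] (G : SimultaneousGame I X R) (π : ∀ j, X j) : Set (∀ j, X j) :=
  ⋂ i, {σ | (G.unilateral i π, σ i) ∈ (G.φ i).diagonal}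

/-- A generalised Nash equilibrium: a fixed point of the best response correspondence. -/
def IsNashEquilibrium [DecidableEq I] (G : SimultaneousGame I X R) (π : ∀ j, X j) : Prop :=
  π ∈ G.bestResponse π

/-- A finite game: finitely many players and moves, outcome spaces that are real topological
vector spaces (`T₁`, as all topological vector spaces considered here), and total quantifiers
that have closed graph for pointwise convergence and closed and convex values. -/
structure IsFinite [∀ i, AddCommGroup (R i)] [∀ i, Module ℝ (R i)]
    [∀ i, TopologicalSpace (R i)] (G : SimultaneousGame I X R) : Prop where
  finite_players : Finite I
  finite_moves : ∀ i, Finite (X i)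
  isTopologicalAddGroup : ∀ i, IsTopologicalAddGroup (R i)
  continuousSMul : ∀ i, ContinuousSMul ℝ (R i)
  t1Space : ∀ i, T1Space (R i)
  total : ∀ i, (G.φ i).IsTotal
  closedGraph : ∀ i, HasClosedGraph (G.φ i)
  isClosed : ∀ i p, IsClosed (G.φ i p)
  convex : ∀ i p, Convex ℝ (G.φ i p)

/-- The mixed extension `G*` of a game: the moves of player `i` are the points of the standard
simplex with vertices indexed by `X i`, outcomes are the multilinear expected outcomes, and the
quantifiers are `φ* i p = φ i (p ∘ δ i)`, where `δ i` sends a move to the corresponding vertex. -/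
noncomputable def mixedExtension [Fintype I] [DecidableEq I] [∀ i, Fintype (X i)]
    [∀ i, DecidableEq (X i)] [∀ i, AddCommGroup (R i)] [∀ i, Module ℝ (R i)]
    (G : SimultaneousGame I X R) :
    SimultaneousGame I (fun i => ↥(stdSimplex ℝ (X i))) R where
  nonempty_players := G.nonempty_players
  nonempty_moves := fun i =>
    (G.nonempty_moves i).map fun x => ⟨Pi.single x 1, single_mem_stdSimplex ℝ x⟩
  q := fun i π => ∑ σ : (∀ j, X j), (∏ j, (π j : X j → ℝ) (σ j)) • G.q i σ
  φ := fun i p => G.φ i fun x => p ⟨Pi.single x 1, single_mem_stdSimplex ℝ x⟩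

end SimultaneousGame

/-! Let player `i` regard a pure move `x` as good at `π` if deviating to `x` has an outcome in the
quantifier's value at `π`. By closed graph and continuity each set of profiles where `x` is good is
closed; by totality and attainment these sets cover. If every move played with positive weight is
good, multilinearity writes the outcome at `π` as a convex combination of good outcomes, and
convexity of the value gives equilibrium. Such a `π` comes from a covering theorem,
`exists_mem_pi_stdSimplex_forall_pos_mem`. It reduces to one simplex, where it is the limit of a
combinatorial statement on ever finer grids; that statement is Scarf's lemma,
`Scarf.exists_colorful_room`, proved by parity. No convexity of the outcome spaces' topology is
needed, since all topology happens in the simplices. -/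

open Function Filter Topology

/-- A finset carrying a symmetric irreflexive relation under which every element has exactly one
partner has even cardinality. -/
theorem Finset.even_card_of_existsUnique_partner {β : Type*} (F : Finset β) (P : β → β → Prop)
    (symm : ∀ x y, P x y → P y x) (irrefl : ∀ x, ¬ P x x)
    (ex : ∀ x ∈ F, ∃ y ∈ F, P x y) (uniq : ∀ x y z, P x y → P x z → y = z) :
    Even F.card := by
  choose g hgF hgP using ex
  have h : ∑ _x ∈ F, (1 : ZMod 2) = 0 := by
    refine Finset.sum_involution g (fun _ _ => by decide) (fun x hx _ h => ?_) hgF (fun x hx => ?_)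
    · exact irrefl x (by simpa [h] using hgP x hx)
    · exact uniq _ _ _ (hgP _ (hgF x hx)) (symm _ _ (hgP x hx))
  rw [Finset.sum_const, nsmul_eq_mul, mul_one] at h
  exact (ZMod.natCast_eq_zero_iff_even).1 h

/-! ### Scarf's lemma by double counting modulo 2. -/

namespace Scarf

variable {ι V α : Type*} [LinearOrder α] (r : ι → V → α)

/-- A family `f` of distinct vertices is a room of the system of orders induced by `r` if `f i` is
its least member in the `i`-th order and no vertex exceeds `f i` in the `i`-th order for
every `i`. -/
structure IsRoom (f : ι → V) : Prop where
  injective : Injective f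
  le : ∀ i j, r i (f i) ≤ r i (f j)
  dominant : ∀ y, ∃ i, r i y ≤ r i (f i)

variable {r}

/-- Dominance of `f` bounds `g b` by `f i` in some order `i`; an `i ≠ b` would make `g i` and `g b`
coincide. -/
theorem IsRoom.le_of_eqOn {f g : ι → V} (hr : ∀ i, Injective (r i)) (hf : IsRoom r f)
    (hg : IsRoom r g) {b : ι} (h : ∀ j, j ≠ b → f j = g j) : r b (g b) ≤ r b (f b) := by
  obtain ⟨i, hi⟩ := hf.dominant (g b)
  by_cases hib : i = b
  · rwa [hib] at hi
  · rw [h i hib] at hi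
    exact absurd (hg.injective (hr i (le_antisymm (hg.le i b) hi))) hib

/-- Two rooms that agree outside one index are equal. -/
theorem IsRoom.eq_of_eqOn {f g : ι → V} (hr : ∀ i, Injective (r i)) (hf : IsRoom r f)
    (hg : IsRoom r g) {b : ι} (h : ∀ j, j ≠ b → f j = g j) : f = g := by
  funext j
  by_cases hj : j = b
  · rw [hj]
    exact hr b (le_antisymm (hg.le_of_eqOn hr hf fun j hj => (h j hj).symm)
      (hf.le_of_eqOn hr hg h))
  · exact h j hj

variable (r) in
/-- Two rooms with a marked index are related if removing the marked vertices leaves the same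
set of vertices and the marked indices differ. -/
structure Pivot (x y : (ι → V) × ι) : Prop where
  left : IsRoom r x.1
  right : IsRoom r y.1
  ne : x.2 ≠ y.2
  swap : y.1 x.2 = x.1 y.2
  eqOn : ∀ j, j ≠ x.2 → j ≠ y.2 → y.1 j = x.1 j

theorem Pivot.symm {x y : (ι → V) × ι} (h : Pivot r x y) : Pivot r y x :=
  ⟨h.right, h.left, h.ne.symm, h.swap.symm, fun j hy hx => (h.eqOn j hx hy).symm⟩

theorem Pivot.le {x y : (ι → V) × ι} (h : Pivot r x y) {j : ι} (hj : j ≠ x.2) :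
    r x.2 (x.1 y.2) ≤ r x.2 (x.1 j) := by
  by_cases hjy : j = y.2
  · rw [hjy]
  · rw [← h.swap, ← h.eqOn j hj hjy]
    exact h.right.le _ _

/-- By `Pivot.le`, the new mark is forced: its vertex in the old room is the least unmarked one in
the order of the old mark. -/
theorem Pivot.unique (hr : ∀ i, Injective (r i)) {x y z : (ι → V) × ι} (hy : Pivot r x y)
    (hz : Pivot r x z) : y = z := by
  have h2 : y.2 = z.2 :=
    hy.left.injective (hr _ (le_antisymm (hy.le hz.ne.symm) (hz.le hy.ne.symm)))
  refine Prod.ext (hy.right.eq_of_eqOn hr hz.right (b := y.2) fun j hj => ?_) h2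
  by_cases hjx : j = x.2
  · rw [hjx, hy.swap, hz.swap, h2]
  · rw [hy.eqOn j hjx hj, hz.eqOn j hjx (h2 ▸ hj)]

theorem exists_pivot [Finite ι] [Finite V] {s : ι → V}
    (hs : ∀ i j v, i ≠ j → v ∉ Set.range s → r i v < r i (s j))
    {x : (ι → V) × ι} (hx : IsRoom r x.1) (hb : ∃ k, k ≠ x.2 ∧ x.1 k ∉ Set.range s) :
    ∃ y, Pivot r x y := by
  classical
  obtain ⟨f, a⟩ := x
  obtain ⟨k, hka, hk⟩ := hb
  dsimp only at hx hka hk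
  obtain ⟨b, hba, hb⟩ := Set.exists_min_image {j | j ≠ a} (fun j => r a (f j)) (Set.toFinite _)
    ⟨k, hka⟩
  simp only [Set.mem_ofPred_eq] at hba hb
  -- Without the marked vertex, `f b` takes over as minimum in order `a`, so index `b` needs a new
  -- vertex. `M` holds the vertices above the minima in all orders except `b`; its greatest member
  -- in order `b` makes the new room dominant.
  let M : Set V := {y | r a (f b) < r a y ∧ ∀ j, j ≠ a → j ≠ b → r j (f j) < r j y}
  have hM : M.Nonempty := ⟨s b, (hb k hka).trans_lt (hs a b _ hba.symm hk), fun j _ hjb =>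
    (hx.le j k).trans_lt (hs j b _ hjb hk)⟩
  obtain ⟨y, ⟨hya, hyj⟩, hy⟩ := Set.exists_max_image M (r b) (Set.toFinite _) hM
  have hyb : r b y ≤ r b (f b) := by
    obtain ⟨i, hi⟩ := hx.dominant y
    by_cases hia : i = a
    · subst hia
      exact absurd (hi.trans (hx.le i b)) hya.not_ge
    · by_cases hib : i = b
      · rwa [hib] at hi
      · exact absurd hi (hyj i hia hib).not_ge
  let g : ι → V := fun j => if j = b then y else if j = a then f b else f j
  have gb : g b = y := if_pos rfl
  have ga : g a = f b := by simp [g, hba.symm]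
  have gj : ∀ j, j ≠ a → j ≠ b → g j = f j := fun j h1 h2 => by simp [g, h1, h2]
  have hyb' : y ≠ f b := fun h => by simp [h] at hya
  have hyj' : ∀ j, j ≠ a → y ≠ f j := fun j h1 h => by
    by_cases h2 : j = b
    · exact hyb' (h2 ▸ h)
    · simpa [h] using hyj j h1 h2
  suffices hg : IsRoom r g from ⟨(g, b), hx, hg, hba.symm, ga, fun j h1 h2 => gj j h1 h2⟩
  refine ⟨fun i j hij => ?_, fun i j => ?_, fun z => ?_⟩
  · have hinj := hx.injective
    by_cases hib : i = b <;> by_cases hjb : j = b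
    · rw [hib, hjb]
    · subst hib
      by_cases hja : j = a
      · subst hja; rw [gb, ga] at hij; exact absurd hij hyb'
      · rw [gb, gj j hja hjb] at hij; exact absurd hij (hyj' j hja)
    · subst hjb
      by_cases hia : i = a
      · subst hia; rw [gb, ga] at hij; exact absurd hij.symm hyb'
      · rw [gb, gj i hia hib] at hij; exact absurd hij.symm (hyj' i hia)
    · by_cases hia : i = a <;> by_cases hja : j = a
      · rw [hia, hja]
      · subst hia; rw [ga, gj j hja hjb] at hij; exact absurd (hinj hij).symm hjb
      · subst hja; rw [ga, gj i hia hib] at hij; exact absurd (hinj hij) hib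
      · rw [gj i hia hib, gj j hja hjb] at hij; exact hinj hij
  · by_cases hib : i = b
    · subst hib
      rw [gb]
      by_cases hji : j = i
      · rw [hji, gb]
      · by_cases hja : j = a
        · rwa [hja, ga]
        · rw [gj j hja hji]; exact hyb.trans (hx.le i j)
    · by_cases hia : i = a
      · subst hia
        rw [ga]
        by_cases hjb : j = b
        · rw [hjb, gb]; exact hya.le
        · by_cases hji : j = i
          · rw [hji, ga]
          · rw [gj j hji hjb]; exact hb j hji
      · rw [gj i hia hib]
        by_cases hjb : j = b
        · rw [hjb, gb]; exact (hyj i hia hib).le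
        · by_cases hja : j = a
          · rw [hja, ga]; exact hx.le i b
          · rw [gj j hja hjb]; exact hx.le i j
  · by_cases hz : z ∈ M
    · exact ⟨b, gb.symm ▸ hy z hz⟩
    · by_contra! hcon
      refine hz ⟨ga ▸ hcon a, fun j hja hjb => ?_⟩
      rw [← gj j hja hjb]
      exact hcon j

/-- **Scarf's lemma.** Let finitely many vertices carry one order for each index and a colouring
by the indices, and let `s i` be a vertex of colour `i` that is least in the `i`-th order and
exceeds all vertices outside the range of `s` in the other orders. If there is a vertex outside
that range, then some room contains every colour exactly once. -/
theorem exists_colorful_room [Finite ι] [Nonempty ι] [Finite V] (hr : ∀ i, Injective (r i))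
    (c : V → ι) (s : ι → V) (hcs : ∀ i, c (s i) = i) (hbot : ∀ i v, r i (s i) ≤ r i v)
    (htop : ∀ i j v, i ≠ j → v ∉ Set.range s → r i v < r i (s j))
    (hv : ∃ v, v ∉ Set.range s) : ∃ f, IsRoom r f ∧ Bijective fun i => c (f i) := by
  classical
  by_contra! hno
  have := Fintype.ofFinite ι
  have := Fintype.ofFinite V
  obtain ⟨i₀⟩ := ‹Nonempty ι›
  -- The unmarked vertices carry each colour other than `i₀` exactly once.
  let Good (x : (ι → V) × ι) : Prop := Bijective (update (fun i => c (x.1 i)) x.2 i₀)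
  let F : Finset ((ι → V) × ι) := {x | IsRoom r x.1 ∧ Good x}
  have hswap (h h' : ι → ι) (a b : ι) (hab : a ≠ b) (h1 : h' a = h b)
      (h2 : ∀ j, j ≠ a → j ≠ b → h' j = h j) :
      update h' b i₀ = update h a i₀ ∘ Equiv.swap a b := by
    funext j
    by_cases hjb : j = b
    · subst hjb; simp
    · by_cases hja : j = a
      · subst hja; simp [hab, hab.symm, h1]
      · simp [Equiv.swap_apply_of_ne_of_ne hja hjb, hja, hjb, h2]
  -- Keep the room and move the mark to the other vertex of the same colour; it exists because no
  -- room is colourful.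
  have hF : Even F.card := by
    refine F.even_card_of_existsUnique_partner
      (fun x y => x.1 = y.1 ∧ x.2 ≠ y.2 ∧ c (x.1 x.2) = c (x.1 y.2) ∧ Good x ∧ Good y)
      ?_ ?_ ?_ ?_
    · rintro ⟨f, a⟩ ⟨g, b⟩ ⟨rfl, h2, h3, h4, h5⟩
      exact ⟨rfl, h2.symm, h3.symm, h5, h4⟩
    · exact fun x h => h.2.1 rfl
    · rintro ⟨f, a⟩ hx
      obtain ⟨hroom, hgood⟩ := (Finset.mem_filter.1 hx).2
      dsimp only at hroom
      have hne : c (f a) ≠ i₀ := fun h => hno f hroom <| by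
        have : update (fun i => c (f i)) a i₀ = fun i => c (f i) := by
          rw [← h]; exact update_eq_self a _
        rw [← this]; exact hgood
      obtain ⟨b, hb⟩ := hgood.2 (c (f a))
      have hba : b ≠ a := by
        rintro rfl
        exact hne (by simpa using hb.symm)
      replace hb : c (f b) = c (f a) := by simpa [hba] using hb
      have hgb : Good (f, b) := by
        have := hswap (fun i => c (f i)) (fun i => c (f i)) a b hba.symm hb.symm
          (fun _ _ _ => rfl)
        change Bijective (update (fun i => c (f i)) b i₀)
        rw [this]
        exact hgood.comp (Equiv.bijective _)
      exact ⟨(f, b), Finset.mem_filter.2 ⟨Finset.mem_univ _, hroom, hgb⟩, rfl, hba.symm, hb.symm,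
        hgood, hgb⟩
    · rintro ⟨f, a⟩ ⟨g, b⟩ ⟨g', b'⟩ ⟨rfl, h2, h3, h4, h5⟩ ⟨rfl, h2', h3', h4', h5'⟩
      dsimp only at *
      have : b = b' := h4.1 (by simp [h2.symm, h2'.symm, ← h3, ← h3'])
      rw [this]
  have hboundary (x : (ι → V) × ι) (hx : x ∈ F) (h : ∀ k, k ≠ x.2 → x.1 k ∈ Set.range s) :
      x.2 = i₀ ∧ ∀ j, j ≠ i₀ → x.1 j = s j := by
    obtain ⟨f, a⟩ := x
    obtain ⟨hroom, hgood⟩ := (Finset.mem_filter.1 hx).2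
    dsimp only at *
    have key (j : ι) (hj : j ≠ i₀) : j ≠ a ∧ f j = s j := by
      obtain ⟨k, hk⟩ := hgood.2 j
      have hka : k ≠ a := by
        rintro rfl
        exact hj (by simpa using hk.symm)
      replace hk : c (f k) = j := by simpa [hka] using hk
      obtain ⟨l, hl⟩ := h k hka
      rw [← hl, hcs] at hk
      subst hk
      have h1 : f l = s l :=
        hr l (le_antisymm (by simpa [hl] using hroom.le l k) (hbot l (f l)))
      have h2 : l = k := hroom.injective (h1.trans hl)
      exact ⟨h2 ▸ hka, h1⟩
    refine ⟨?_, fun j hj => (key j hj).2⟩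
    by_contra hne
    exact (key a hne).1 rfl
  obtain ⟨y, hy, hymax⟩ := Set.exists_max_image {v | v ∉ Set.range s} (r i₀) (Set.toFinite _) hv
  simp only [Set.mem_ofPred_eq] at hy hymax
  have hsinj : Injective s := fun i j h => by rw [← hcs i, h, hcs]
  have hx₀ : (update s i₀ y, i₀) ∈ F := by
    refine Finset.mem_filter.2 ⟨Finset.mem_univ _, ⟨fun i j hij => ?_, fun i j => ?_, fun z => ?_⟩,
      ?_⟩
    · dsimp only at hij
      by_cases hi : i = i₀ <;> by_cases hj : j = i₀
      · rw [hi, hj]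
      · subst hi; simp [hj] at hij; exact absurd ⟨j, hij.symm⟩ hy
      · subst hj; simp [hi] at hij; exact absurd ⟨i, hij⟩ hy
      · simp [hi, hj] at hij; exact hsinj hij
    · dsimp only
      by_cases hi : i = i₀
      · by_cases hj : j = i₀
        · rw [hi, hj]
        · subst hi; simpa [hj] using (htop i j y (Ne.symm hj) hy).le
      · simpa [hi] using hbot i _
    · dsimp only
      by_cases hz : z ∈ Set.range s
      · obtain ⟨j, rfl⟩ := hz
        by_cases hj : j = i₀
        · exact ⟨j, hbot j _⟩
        · exact ⟨j, by simp [hj]⟩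
      · exact ⟨i₀, by simpa using hymax z hz⟩
    · have : update (fun i => c (update s i₀ y i)) i₀ i₀ = id := by
        funext j
        by_cases hj : j = i₀
        · subst hj; simp
        · simp [hj, hcs]
      change Bijective (update (fun i => c (update s i₀ y i)) i₀ i₀)
      rw [this]
      exact bijective_id
  -- Now keep the unmarked vertices and change the room. Only the pair whose unmarked vertices are
  -- the `s j` with `j ≠ i₀` has no partner, so `F` has odd cardinality as well.
  have hE : Even (F.erase (update s i₀ y, i₀)).card := by
    refine Finset.even_card_of_existsUnique_partner _ (Pivot r) (fun _ _ => Pivot.symm)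
      (fun x h => h.ne rfl) (fun x hx => ?_) (fun x y z => Pivot.unique hr)
    obtain ⟨hne, hxF⟩ := Finset.mem_erase.1 hx
    obtain ⟨hroom, hgood⟩ := (Finset.mem_filter.1 hxF).2
    have hb : ∃ k, k ≠ x.2 ∧ x.1 k ∉ Set.range s := by
      by_contra! h
      obtain ⟨h2, h1⟩ := hboundary x hxF h
      refine hne (Prod.ext ?_ h2)
      exact hroom.eq_of_eqOn hr ((Finset.mem_filter.1 hx₀).2.1) (b := i₀)
        fun j hj => by simp [hj, h1 j hj]
    obtain ⟨z, hz⟩ := exists_pivot htop hroom hb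
    refine ⟨z, Finset.mem_erase.2 ⟨?_, Finset.mem_filter.2 ⟨Finset.mem_univ _, hz.right, ?_⟩⟩, hz⟩
    · rintro rfl
      obtain ⟨k, hk, hks⟩ := hb
      have h1 := hz.eqOn k hk
      have h2 := hz.swap
      have h3 := hz.ne
      dsimp only at h1 h2 h3
      by_cases hki : k = i₀
      · subst hki
        rw [update_of_ne h3] at h2
        exact hks ⟨_, h2⟩
      · rw [update_of_ne hki] at h1
        exact hks ⟨_, h1 hki⟩
    · have := hswap (fun i => c (x.1 i)) (fun i => c (z.1 i)) x.2 z.2 hz.ne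
        (congrArg c hz.swap) (fun j h1 h2 => congrArg c (hz.eqOn j h1 h2))
      change Bijective (update (fun i => c (z.1 i)) z.2 i₀)
      rw [this]
      exact hgood.comp (Equiv.bijective _)
  rw [Finset.card_erase_of_mem hx₀] at hE
  have hpos := Finset.card_pos.2 ⟨_, hx₀⟩
  rw [Nat.even_sub hpos] at hE
  simp [hF] at hE

end Scarf

/-! ### From grids to closed covers of a simplex. -/

/-- A function of sum at most `N` is dominated by one of sum exactly `N`. -/
theorem exists_le_sum_eq {ι : Type*} [Fintype ι] [Nonempty ι] (m : ι → ℕ) {N : ℕ}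
    (h : ∑ i, m i ≤ N) : ∃ y : ι → ℕ, ∑ i, y i = N ∧ ∀ i, m i ≤ y i := by
  classical
  obtain ⟨a⟩ := ‹Nonempty ι›
  refine ⟨fun i => m i + if i = a then N - ∑ i, m i else 0, ?_, fun i => Nat.le_add_right _ _⟩
  rw [Finset.sum_add_distrib]
  simp
  omega

/-- A colouring of the points of the grid of mesh `1 / N` in the simplex admits a grid point `v`
such that each coordinate `k` is small at `v` or the colour `k` occurs close to `v`. -/
theorem exists_grid_point_near_all_colors {ι : Type*} [Fintype ι] [Nonempty ι] (N : ℕ)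
    (c : (ι → ℕ) → ι) :
    ∃ v : ι → ℕ, ∑ i, v i = N ∧ ∀ k, v k ≤ Fintype.card ι ∨ ∃ u : ι → ℕ, ∑ i, u i = N ∧
      c u = k ∧ ∀ i, v i ≤ u i + Fintype.card ι ∧ u i ≤ v i + Fintype.card ι := by
  classical
  let T := {v : ι → ℕ // v ∈ Finset.piAntidiag Finset.univ N}
  have memT (v : ι → ℕ) : v ∈ Finset.piAntidiag Finset.univ N ↔ ∑ i, v i = N := by simp
  let V := T ⊕ ι
  have : Fintype V := inferInstanceAs (Fintype (Finset.piAntidiag Finset.univ N ⊕ ι))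
  -- The shift by 1 puts slack vertex `i` strictly below the grid in order `i`; `N + 2` puts it
  -- strictly above in the other orders. Ties are broken by `e`.
  let coord (i : ι) : V → ℕ := Sum.elim (fun v => v.1 i + 1) fun j => if i = j then 0 else N + 2
  let e := Fintype.equivFin V
  let r (i : ι) (v : V) : ℕ ×ₗ Fin (Fintype.card V) := toLex (coord i v, e v)
  have hr (i : ι) : Injective (r i) := fun v w h =>
    e.injective (Prod.ext_iff.1 (toLex.injective h)).2
  have r_lt {i : ι} {v w : V} (h : coord i v < coord i w) : r i v < r i w :=
    Prod.Lex.toLex_lt_toLex.2 (Or.inl h)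
  have r_le {i : ι} {v w : V} (h : r i v ≤ r i w) : coord i v ≤ coord i w :=
    not_lt.1 fun h' => (r_lt h').not_ge h
  have hle (v : T) (i : ι) : v.1 i ≤ N :=
    (Finset.single_le_sum (f := v.1) (fun _ _ => Nat.zero_le _) (Finset.mem_univ i)).trans
      ((memT _).1 v.2).le
  have htop (i j : ι) (hij : i ≠ j) (v : T) : r i (Sum.inl v) < r i (Sum.inr j) := by
    refine r_lt ?_
    have := hle v i
    simp only [coord, Sum.elim_inl, Sum.elim_inr, if_neg hij]
    omega
  have hbot (i : ι) (v : V) : r i (Sum.inr i) ≤ r i v := by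
    obtain v | j := v
    · exact (r_lt (by simp [coord])).le
    · by_cases hij : i = j
      · rw [hij]
      · exact (r_lt (by simp [coord, hij])).le
  obtain ⟨y₀, hy₀, -⟩ := exists_le_sum_eq (fun _ : ι => 0) (N := N) (by simp)
  obtain ⟨f, hf, hcf⟩ := Scarf.exists_colorful_room hr (Sum.elim (fun v => c v.1) id) Sum.inr
    (fun _ => rfl) hbot
    (fun i j v hij hv => by
      obtain v | l := v
      · exact htop i j hij v
      · exact absurd ⟨l, rfl⟩ hv)
    ⟨Sum.inl ⟨y₀, (memT _).2 hy₀⟩, by simp⟩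
  have hslack (j l : ι) (h : f j = Sum.inr l) : f l = Sum.inr l :=
    hr l (le_antisymm (h ▸ hf.le l j) (hbot l _))
  obtain ⟨j₀, v, hv⟩ : ∃ j, ∃ v : T, f j = Sum.inl v := by
    by_contra! h
    obtain ⟨i, hi⟩ := hf.dominant (Sum.inl ⟨y₀, (memT _).2 hy₀⟩)
    obtain ⟨j, hj⟩ := hcf.2 i
    have hfi : f i = Sum.inr i := by
      rcases hfj : f j with w | l
      · exact absurd hfj (h j w)
      · simp only [hfj, Sum.elim_inr, id] at hj
        subst hj
        exact hslack j l hfj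
    rw [hfi] at hi
    exact absurd (r_le hi) (by simp [coord])
  have hinr (i l : ι) (h : f i = Sum.inr l) : l = i := by
    by_contra hne
    exact (htop i l (Ne.symm hne) v).not_ge (h ▸ hv ▸ hf.le i j₀)
  -- Truncated subtraction gives 0 when `f i` is a slack vertex.
  let m (i : ι) : ℕ := coord i (f i) - 1
  have hm (j : ι) (u : T) (hu : f j = Sum.inl u) (i : ι) : m i ≤ u.1 i := by
    have := r_le (hf.le i j)
    rw [hu] at this
    simp only [coord, Sum.elim_inl] at this
    simp only [m, coord]
    omega
  -- Otherwise some grid point would exceed every `f i`, against dominance. As grid points of the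
  -- room lie above `m` and have sum `N`, each is within `Fintype.card ι` of `m` in every
  -- coordinate.
  have hsum : N < ∑ i, (m i + 1) := by
    by_contra! h
    obtain ⟨y, hy, hmy⟩ := exists_le_sum_eq _ h
    obtain ⟨i, hi⟩ := hf.dominant (Sum.inl ⟨y, (memT _).2 hy⟩)
    have h1 := r_le hi
    have h2 := hmy i
    simp only [m, coord, Sum.elim_inl] at h1 h2
    omega
  rw [Finset.sum_add_distrib] at hsum
  simp only [Finset.sum_const, Finset.card_univ, smul_eq_mul, mul_one] at hsum
  have hM (j : ι) (u : T) (hu : f j = Sum.inl u) (i : ι) : u.1 i ≤ m i + Fintype.card ι := by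
    have h1 := (memT _).1 u.2
    have h2 := Finset.add_sum_erase Finset.univ u.1 (Finset.mem_univ i)
    have h3 := Finset.add_sum_erase Finset.univ m (Finset.mem_univ i)
    have h4 := Finset.sum_le_sum fun k (_ : k ∈ Finset.univ.erase i) => hm j u hu k
    omega
  refine ⟨v.1, (memT _).1 v.2, fun k => ?_⟩
  obtain ⟨j, hj⟩ := hcf.2 k
  rcases hfj : f j with u | l
  · refine Or.inr ⟨u.1, (memT _).1 u.2, by simpa [hfj] using hj, fun i => ?_⟩
    have h1 := hm j u hfj i
    have h2 := hm j₀ v hv i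
    have h3 := hM j u hfj i
    have h4 := hM j₀ v hv i
    omega
  · left
    have hl : l = k := by simpa [hfj] using hj
    subst hl
    have h := hM j₀ v hv l
    have h0 : m l = 0 := by simp [m, coord, hslack j l hfj]
    omega

theorem natCast_div_mem_stdSimplex {ι : Type*} [Fintype ι] {v : ι → ℕ} {N : ℕ} (hN : N ≠ 0)
    (h : ∑ i, v i = N) : (fun i => (v i : ℝ) / N) ∈ stdSimplex ℝ ι := by
  refine ⟨fun i => by positivity, ?_⟩
  rw [← Finset.sum_div, ← Nat.cast_sum, h, div_self (by exact_mod_cast hN)]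

/-- If closed sets `C k`, indexed by the vertices, cover the standard simplex, then some point of
the simplex lies in `C k` for all vertices `k` of the least face that contains it. -/
theorem exists_mem_stdSimplex_forall_pos_mem {ι : Type*} [Fintype ι] [Nonempty ι]
    (C : ι → Set (stdSimplex ℝ ι)) (hC : ∀ k, IsClosed (C k)) (hcover : ∀ w, ∃ k, w ∈ C k) :
    ∃ w : stdSimplex ℝ ι, ∀ k, 0 < (w : ι → ℝ) k → w ∈ C k := by
  choose col hcol using hcover
  let pt (n : ℕ) (v : ι → ℕ) : ι → ℝ := fun i => (v i : ℝ) / (n + 1 : ℕ)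
  have hpt {n : ℕ} {v : ι → ℕ} (h : ∑ i, v i = n + 1) : pt n v ∈ stdSimplex ℝ ι :=
    natCast_div_mem_stdSimplex n.succ_ne_zero h
  let ε (n : ℕ) : ℝ := (Fintype.card ι : ℝ) / (n + 1 : ℕ)
  have hε : Tendsto ε atTop (𝓝 0) :=
    (tendsto_add_atTop_iff_nat 1).2 (tendsto_const_div_atTop_nhds_zero_nat (Fintype.card ι : ℝ))
  have key (n : ℕ) : ∃ w : stdSimplex ℝ ι, ∀ k, (w : ι → ℝ) k ≤ ε n ∨
      ∃ u ∈ C k, dist w u ≤ ε n := by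
    classical
    obtain ⟨v, hv, h⟩ := exists_grid_point_near_all_colors (n + 1) fun v : ι → ℕ =>
      if hv : ∑ i, v i = n + 1 then col ⟨pt n v, hpt hv⟩ else Classical.arbitrary ι
    refine ⟨⟨pt n v, hpt hv⟩, fun k => ?_⟩
    rcases h k with h | ⟨u, hu, huk, h⟩
    · left
      change (v k : ℝ) / (n + 1 : ℕ) ≤ Fintype.card ι / (n + 1 : ℕ)
      gcongr
    · rw [dif_pos hu] at huk
      refine Or.inr ⟨⟨pt n u, hpt hu⟩, huk ▸ hcol _, ?_⟩
      rw [Subtype.dist_eq, dist_pi_le_iff (by positivity)]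
      intro i
      change dist ((v i : ℝ) / (n + 1 : ℕ)) ((u i : ℝ) / (n + 1 : ℕ)) ≤ _
      rw [Real.dist_eq, ← sub_div, abs_div, abs_of_nonneg (Nat.cast_nonneg (α := ℝ) (n + 1))]
      refine div_le_div_of_nonneg_right ?_ (Nat.cast_nonneg _)
      have h1 : (v i : ℝ) ≤ u i + Fintype.card ι := by exact_mod_cast (h i).1
      have h2 : (u i : ℝ) ≤ v i + Fintype.card ι := by exact_mod_cast (h i).2
      rw [abs_le]
      constructor <;> linarith
  choose x hx using key
  have : CompactSpace (stdSimplex ℝ ι) := isCompact_iff_compactSpace.1 (isCompact_stdSimplex ℝ ι)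
  obtain ⟨w, φ, hφ, hw⟩ := CompactSpace.tendsto_subseq x
  -- If `w k > 0`, the `k`-th coordinate eventually beats the mesh error, which leaves only the
  -- alternative of nearby points of `C k`.
  refine ⟨w, fun k hk => (hC k).closure_eq ▸ Metric.mem_closure_iff.2 fun δ hδ => ?_⟩
  have hεφ := hε.comp hφ.tendsto_atTop
  have hwk : Tendsto (fun n => (x (φ n) : ι → ℝ) k) atTop (𝓝 ((w : ι → ℝ) k)) :=
    (((continuous_apply k).comp continuous_subtype_val).tendsto w).comp hw
  have h1 := hεφ.eventually_lt hwk hk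
  have h2 := hεφ.eventually_lt_const (half_pos hδ)
  have h3 := (tendsto_iff_dist_tendsto_zero.1 hw).eventually_lt_const (half_pos hδ)
  obtain ⟨n, h1, h2, h3⟩ := (h1.and (h2.and h3)).exists
  dsimp only [Function.comp] at h1 h2 h3
  rcases hx (φ n) k with h | ⟨u, hu, h⟩
  · exact absurd h h1.not_ge
  · refine ⟨u, hu, ?_⟩
    rw [dist_comm] at h3
    linarith [dist_triangle w (x (φ n)) u]

/-! ### Covers of a product of simplices. -/

/-- For every `i`, let closed sets `C i x`, indexed by the vertices `x` of the `i`-th simplex, cover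
a product of standard simplices. Then some point `π` of the product lies in `C i x` for all `i` and
all vertices `x` of the least face that contains `π i`. -/
theorem exists_mem_pi_stdSimplex_forall_pos_mem {I : Type*} {X : I → Type*} [Fintype I]
    [Nonempty I] [∀ i, Fintype (X i)] [∀ i, Nonempty (X i)]
    (C : ∀ i, X i → Set (∀ j, stdSimplex ℝ (X j))) (hC : ∀ i x, IsClosed (C i x))
    (hcover : ∀ i π, ∃ x, π ∈ C i x) :
    ∃ π : ∀ j, stdSimplex ℝ (X j), ∀ i x, 0 < (π i : X i → ℝ) x → π ∈ C i x := by
  classical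
  let Δ := stdSimplex ℝ (Σ i, X i)
  let μ : ℝ := (Fintype.card I : ℝ)⁻¹
  have hμ : 0 < μ := by positivity
  let mass (i : I) (w : Δ) : ℝ := ∑ x, (w : (Σ i, X i) → ℝ) ⟨i, x⟩
  have hcont (k : Σ i, X i) : Continuous fun w : Δ => (w : (Σ i, X i) → ℝ) k :=
    (continuous_apply k).comp continuous_subtype_val
  have hmass (i : I) : Continuous (mass i) := continuous_finsetSum _ fun x _ => hcont _
  have hmass_sum (w : Δ) : ∑ i, mass i w = 1 := by
    rw [← w.2.2, Fintype.sum_sigma]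
    rfl
  have hpos (i : I) (w : Δ) : 0 < max (mass i w) μ := lt_max_of_lt_right hμ
  -- Each block of weights is normalised; a block with mass below `μ` is first topped up at one
  -- vertex, which keeps the map continuous.
  let num (w : Δ) (i : I) (x : X i) : ℝ := (w : (Σ i, X i) → ℝ) ⟨i, x⟩ +
    if x = Classical.arbitrary (X i) then max (μ - mass i w) 0 else 0
  have hnum (w : Δ) (i : I) :
      (fun x => num w i x / max (mass i w) μ) ∈ stdSimplex ℝ (X i) := by
    refine ⟨fun x => div_nonneg (add_nonneg (w.2.1 _) ?_) (hpos i w).le, ?_⟩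
    · split_ifs
      · exact le_max_right _ _
      · exact le_rfl
    · rw [← Finset.sum_div, Finset.sum_add_distrib, Finset.sum_ite_eq' Finset.univ,
        if_pos (Finset.mem_univ _), div_eq_one_iff_eq (hpos i w).ne']
      change mass i w + _ = _
      rw [← max_add_add_left, add_sub_cancel, add_zero, max_comm]
  let ρ (w : Δ) : ∀ i, stdSimplex ℝ (X i) := fun i => ⟨_, hnum w i⟩
  have hρ : Continuous ρ := by
    refine continuous_pi fun i => Continuous.subtype_mk (continuous_pi fun x => ?_) _
    refine Continuous.div ((hcont _).add ?_) ((hmass i).max continuous_const)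
      fun w => (hpos i w).ne'
    split_ifs
    · exact (continuous_const.sub (hmass i)).max continuous_const
    · exact continuous_const
  -- Requiring least mass forces balance: a block of greatest mass has a positive weight, so its
  -- mass is also least, and all masses equal `μ`. There no topping up occurs.
  let D (k : Σ i, X i) : Set Δ := {w | (∀ j, mass k.1 w ≤ mass j w) ∧ ρ w ∈ C k.1 k.2}
  have hD (k : Σ i, X i) : IsClosed (D k) := by
    refine IsClosed.inter ?_ ((hC k.1 k.2).preimage hρ)
    change IsClosed {w | ∀ j, mass k.1 w ≤ mass j w}
    simp only [Set.ofPred_forall]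
    exact isClosed_iInter fun j => isClosed_le (hmass _) (hmass _)
  have : Nonempty (Σ i, X i) := Nonempty.elim ‹Nonempty I› fun i => ⟨i, Classical.arbitrary _⟩
  obtain ⟨w, hw⟩ := exists_mem_stdSimplex_forall_pos_mem D hD fun w => by
    obtain ⟨i, hi⟩ := Finite.exists_min fun i => mass i w
    obtain ⟨x, hx⟩ := hcover i (ρ w)
    exact ⟨⟨i, x⟩, hi, hx⟩
  obtain ⟨i₀, hi₀⟩ := Finite.exists_max fun i => mass i w
  have hmin (j : I) : mass i₀ w ≤ mass j w := by
    obtain ⟨x, hx⟩ : ∃ x, 0 < (w : (Σ i, X i) → ℝ) ⟨i₀, x⟩ := by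
      by_contra! h
      have h0 : mass i₀ w ≤ 0 := Finset.sum_nonpos fun x _ => h x
      have := hmass_sum w ▸ Finset.sum_nonpos fun i (_ : i ∈ Finset.univ) => (hi₀ i).trans h0
      linarith
    exact (hw _ hx).1 j
  have heq (j : I) : mass j w = μ := by
    have h : ∀ i, mass i w = mass j w := fun i =>
      (((hi₀ i).trans (hmin j)).antisymm ((hi₀ j).trans (hmin i)))
    have := hmass_sum w
    simp only [h, Finset.sum_const, Finset.card_univ, nsmul_eq_mul] at this
    exact eq_inv_of_mul_eq_one_right this
  refine ⟨ρ w, fun i x hx => (hw ⟨i, x⟩ ?_).2⟩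
  have h1 : 0 < num w i x := (div_pos_iff_of_pos_right (hpos i w)).1 hx
  simpa [num, heq] using h1

/-! ### Multilinearity of expected outcomes and existence of equilibrium. -/

namespace SimultaneousGame

variable {I : Type u} {X : I → Type v} {R : I → Type w}
    [Fintype I] [DecidableEq I] [∀ i, Fintype (X i)] [∀ i, DecidableEq (X i)]
    [∀ i, AddCommGroup (R i)] [∀ i, Module ℝ (R i)]

theorem continuous_mixedExtension_q [∀ i, TopologicalSpace (R i)]
    (G : SimultaneousGame I X R) (i : I) [IsTopologicalAddGroup (R i)]
    [ContinuousSMul ℝ (R i)] : Continuous (G.mixedExtension.q i) := by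
  refine continuous_finsetSum _ fun σ _ => Continuous.smul ?_ continuous_const
  exact continuous_finsetProd _ fun j _ =>
    (continuous_apply (σ j)).comp (continuous_subtype_val.comp (continuous_apply j))

/-- The expected outcome of a mixed strategy profile is the mean of the outcomes of the pure
deviations of a player, weighted by the strategy of that player. -/
theorem mixedExtension_q_eq_sum (G : SimultaneousGame I X R) (i : I)
    (π : ∀ j, stdSimplex ℝ (X j)) :
    G.mixedExtension.q i π = ∑ x, (π i : X i → ℝ) x •
      G.mixedExtension.q i (update π i ⟨Pi.single x 1, single_mem_stdSimplex ℝ x⟩) := by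
  have key (a : stdSimplex ℝ (X i)) (σ : ∀ j, X j) :
      ∏ j, (update π i a j : X j → ℝ) (σ j) =
        (a : X i → ℝ) (σ i) * ∏ j ∈ Finset.univ.erase i, (π j : X j → ℝ) (σ j) := by
    rw [← Finset.mul_prod_erase _ _ (Finset.mem_univ i), update_self]
    congr 1
    refine Finset.prod_congr rfl fun j hj => ?_
    rw [update_of_ne (Finset.ne_of_mem_erase hj)]
  simp only [mixedExtension, key, Finset.smul_sum]
  rw [Finset.sum_comm]
  refine Finset.sum_congr rfl fun σ _ => ?_
  simp only [smul_smul, ← mul_assoc]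
  rw [← Finset.sum_smul, ← Finset.sum_mul, ← Finset.mul_prod_erase _ _ (Finset.mem_univ i)]
  simp [Pi.single_apply]

end SimultaneousGame

/-- A convex combination lies in a convex set if the points of positive weight do. -/
theorem Convex.sum_mem_of_forall_pos {κ E : Type*} [Fintype κ] [AddCommGroup E] [Module ℝ E]
    {s : Set E} (hs : Convex ℝ s) {a : κ → ℝ} (ha : a ∈ stdSimplex ℝ κ) {z : κ → E}
    (hz : ∀ x, 0 < a x → z x ∈ s) : ∑ x, a x • z x ∈ s := by
  classical
  have hpos {x : κ} (h : a x ≠ 0) : 0 < a x := (ha.1 x).lt_of_ne' h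
  rw [← Finset.sum_filter_of_ne (p := fun x => 0 < a x) fun x _ h =>
    hpos fun h0 => h (by rw [h0, zero_smul])]
  refine hs.sum_mem (fun x _ => ha.1 x) ?_ fun x hx => hz x (Finset.mem_filter.1 hx).2
  rw [Finset.sum_filter_of_ne fun x _ h => hpos h, ha.2]

theorem mainTheorem1 {I : Type u} {X : I → Type v} {R : I → Type w}
    [Fintype I] [DecidableEq I] [∀ i, Fintype (X i)] [∀ i, DecidableEq (X i)]
    [∀ i, AddCommGroup (R i)] [∀ i, Module ℝ (R i)] [∀ i, TopologicalSpace (R i)]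
    (G : SimultaneousGame I X R) (hG : G.IsFinite)
    (hattained : ∀ i, ∃ ε : SelectionFunction (R i) (X i), (G.φ i).IsAttainedBy ε) :
    ∃ π : ∀ i, stdSimplex ℝ (X i), G.mixedExtension.IsNashEquilibrium π := by
  have := G.nonempty_players
  have := G.nonempty_moves
  have := hG.isTopologicalAddGroup
  have := hG.continuousSMul
  let p (i : I) (π : ∀ j, stdSimplex ℝ (X j)) (x : X i) : R i :=
    G.mixedExtension.q i (Function.update π i ⟨Pi.single x 1, single_mem_stdSimplex ℝ x⟩)
  have hp (i : I) : Continuous (p i) := continuous_pi fun x =>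
    (G.continuous_mixedExtension_q i).comp (continuous_id.update i continuous_const)
  obtain ⟨π, hπ⟩ := exists_mem_pi_stdSimplex_forall_pos_mem
    (fun i x => {π | p i π x ∈ G.φ i (p i π)})
    (fun i x => (hG.closedGraph i).preimage
      ((hp i).prodMk ((continuous_apply x).comp (hp i))))
    (fun i π => by
      obtain ⟨ε, hε⟩ := hattained i
      exact ⟨ε (p i π), hε _ (by rw [hG.total i]; trivial)⟩)
  refine ⟨π, Set.mem_iInter.2 fun i => ?_⟩
  -- The current strategy is itself a deviation, so its outcome is averaged over the pure deviations
  -- in its support.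
  change G.mixedExtension.q i (Function.update π i (π i)) ∈ G.φ i (p i π)
  rw [Function.update_eq_self, G.mixedExtension_q_eq_sum i π]
  exact (hG.convex i _).sum_mem_of_forall_pos (π i).2 (hπ i)
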